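/- Augmented virtual double categories are taken in the sense of Koudenburg: they consist of objects, a category of vertical morphisms $f\colon A\to C$, horizontal morphisms $J\colon A\nrightarrow B$, and cells $\phi\colon(J_1,\dots,J_n)\Rightarrow \underline K$ whose horizontal source is a (possibly empty) path and whose horizontal target $\underline K$ is a path of length at most one, with associative and unital vertical composition $\psi\circ(\phi_1,\dots,\phi_n)$ and with horizontal and vertical identity cells $\mathrm{id}_J$, $\mathrm{id}_f$; a cell is nullary if its horizontal target is the empty path at an object $M$ (written $\underline J\Rightarrow M$), and vertical if moreover its horizontal source is empty. Nullary cells into $M$ have a horizontal composite $\phi\odot\psi=\mathrm{id}_M\circ(\phi,\psi)$, and $f\cong g$ means that there is an invertible vertical cell $f\Rightarrow g$. Functors preserve all of this structure strictly. A cell $\psi\colon\underline J\Rightarrow\underline K$ with $|\underline J|\le 1$, vertical source $f$ and vertical target $g$ is cartesian if every cell $\chi\colon\underline H\Rightarrow\underline K$ with vertical source $f\circ h$ and vertical target $g\circ k$ factors uniquely as $\chi=\psi\circ\phi$, with $\phi\colon\underline H\Rightarrow\underline J$ having vertical source $h$ and vertical target $k$. An object $A$ is unital if there is a cartesian nullary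 cell $I_A\Rightarrow A$, for some $I_A\colon A\nrightarrow A$, with identities as vertical source and target; a vertical morphism $f$ is full and faithful if $\mathrm{id}_f$ is cartesian. A nullary cell $\eta\colon\underline J\Rightarrow M$ is left Kan if every nullary cell $\underline J\frown\underline H\Rightarrow M$ with the same vertical source as $\eta$, where $\underline H$ is any (possibly empty) path, factors uniquely as $\eta\odot\phi'$ with $\phi'\colon\underline H\Rightarrow M$; it is weakly left Kan if this holds for empty $\underline H$. A vertical morphism $f\colon A\to M$ is (weakly) dense if every cartesian nullary cell $J\Rightarrow M$ with $J\colon A\nrightarrow B$ a single horizontal morphism and vertical source $f$ is (weakly) left Kan. A (weak) Yoneda morphism is a (weakly) dense $y\colon A\to P$ such that for every $J\colon A\nrightarrow B$ there are a morphism $J^\lambda\colon B\to P$ (which is unique up to isomorphism) and a cartesian cell $J\Rightarrow P$ with vertical source $y$ and vertical target $J^\lambda$, which is said to define $J$ as the restriction $P(y,J^\lambda)$. A (weak) Yoneda embedding is a full and faithful (weak) Yoneda morphism. Let $F\colon\mathcal K\to\mathcal L$ be a functor of augmented virtual double categories. For $P\in\mathcal L$ let $F/P$ be the category with objects the pairs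 $(B,\,f\colon FB\to P)$, and as morphisms $(B,f)\to(C,g)$ the pairs of a path $\underline H\colon B\nrightarrow C$ in $\mathcal K$ and a nullary cell $F\underline H\Rightarrow P$ in $\mathcal L$ from $f$ to $g$, composed horizontally; write $\mathcal K/P'=\mathrm{id}_{\mathcal K}/P'$. A morphism $\varepsilon\colon FP'\to P$ is universal relative to a full subcategory $\mathcal J\subseteq F/P$ if the functor $\varepsilon\circ F-\colon\mathcal K/P'\to F/P$ is full and faithful and factors through $\mathcal J\hookrightarrow F/P$ as an equivalence $\mathcal K/P'\simeq\mathcal J$. **Theorem.** Let $F\colon\mathcal K\to\mathcal L$ be a functor of augmented virtual double categories, $A\in\mathcal K$ a unital object and $y_{FA}\colon FA\to P$ a (weak) Yoneda morphism in $\mathcal L$. Let $(F/P)^\lambda\subseteq F/P$ be the full subcategory of all $(B,f)$ such that $f\cong(FJ)^\lambda$ for some $J\colon A\nrightarrow B$ in $\mathcal K$, and let $\varepsilon\colon FP'\to P$ be universal relative to $(F/P)^\lambda$. Then there exists a morphism $y_A\colon A\to P'$ in $\mathcal K$ such that $y_{FA}\cong\varepsilon\circ Fy_A$. Moreover any such $y_A$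 is a (weak) Yoneda embedding in $\mathcal K$ as long as $\varepsilon\circ F-$ preserves and reflects the cartesian cells that define restrictions of the form $P'(y_A,g)$, that is: for all $g\colon B\to P'$ and $J\colon A\nrightarrow B$, a nullary cell $\eta\colon J\Rightarrow P'$ with vertical source $y_A$ and vertical target $g$ is cartesian in $\mathcal K$ if and only if $\varepsilon\circ F\eta$ is cartesian in $\mathcal L$. Both the version with and the version without "weak" hold. -/

import Mathlib

open CategoryTheory

universe u v w z u' v' w' z'

namespace AVDC

/-! ### Paths of horizontal morphisms -/

/-- Possibly empty paths `(J₁, …, Jₙ) : A₀ ⇸ Aₙ` of horizontal morphisms. -/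
inductive HPath {K : Type u} (H : K → K → Type w) : K → K → Type (max u w)
  | nil (A : K) : HPath H A A
  | cons {A B C : K} (J : H A B) (Js : HPath H B C) : HPath H A C

namespace HPath

variable {K : Type u} {H : K → K → Type w} {L : Type u'} {H' : L → L → Type w'}

/-- Concatenation of paths. -/
@[reducible] def comp : ∀ {A B C : K}, HPath H A B → HPath H B C → HPath H A C
  | _, _, _, nil _, Q => Q
  | _, _, _, cons J P, Q => cons J (comp P Q)

theorem comp_nil : ∀ {A B : K} (P : HPath H A B), P.comp (nil B) = P
  | _, _, nil _ => rfl
  | _, _, cons J P => congrArg (cons J) (comp_nil P)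

theorem comp_assoc : ∀ {A B C D : K} (P : HPath H A B) (Q : HPath H B C) (R : HPath H C D),
    (P.comp Q).comp R = P.comp (Q.comp R)
  | _, _, _, _, nil _, _, _ => rfl
  | _, _, _, _, cons J P, Q, R => congrArg (cons J) (comp_assoc P Q R)

/-- The image of a path under an assignment on horizontal morphisms. -/
@[reducible] def map (o : K → L) (m : ∀ {A B : K}, H A B → H' (o A) (o B)) :
    ∀ {A B : K}, HPath H A B → HPath H' (o A) (o B)
  | _, _, nil A => nil (o A)
  | _, _, cons J P => cons (m J) (map o m P)

theorem map_comp (o : K → L) (m : ∀ {A B : K}, H A B → H' (o A) (o B)) :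
    ∀ {A B C : K} (P : HPath H A B) (Q : HPath H B C),
      (P.comp Q).map o m = (P.map o m).comp (Q.map o m)
  | _, _, _, nil _, _ => rfl
  | _, _, _, cons J P, Q => congrArg (cons (m J)) (map_comp o m P Q)

end HPath

/-- Paths of length at most one: the empty path at `C`, or a single horizontal morphism. -/
inductive Short {K : Type u} (H : K → K → Type w) : K → K → Type (max u w)
  | nul (C : K) : Short H C C
  | un {C D : K} (J : H C D) : Short H C D

namespace Short

variable {K : Type u} {H : K → K → Type w} {L : Type u'} {H' : L → L → Type w'}

/-- A path of length at most one, regarded as a path. -/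
@[reducible] def toPath : ∀ {C D : K}, Short H C D → HPath H C D
  | _, _, .nul C => HPath.nil C
  | _, _, .un J => HPath.cons J (HPath.nil _)

/-- The image of a path of length at most one under an assignment on horizontal morphisms. -/
@[reducible] def map (o : K → L) (m : ∀ {A B : K}, H A B → H' (o A) (o B)) :
    ∀ {C D : K}, Short H C D → Short H' (o C) (o D)
  | _, _, .nul C => .nul (o C)
  | _, _, .un J => .un (m J)

theorem map_toPath (o : K → L) (m : ∀ {A B : K}, H A B → H' (o A) (o B)) :
    ∀ {C D : K} (S : Short H C D), S.toPath.map o m = (S.map o m).toPath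
  | _, _, .nul _ => rfl
  | _, _, .un _ => rfl

end Short

/-! ### Augmented virtual double categories -/

/-- Objects, a category of vertical morphisms, horizontal morphisms, and cells. A cell
`φ : Cell J S f g` has as horizontal source any path `J : A ⇸ B`, as horizontal target a path
`S : C ⇸ D` of length at most one, as vertical source `f : A ⟶ C` and as vertical target
`g : B ⟶ D`. The cell is nullary if `S = nul C`, and unary otherwise; it is a vertical cell if
it is nullary and `J` is empty. -/
class CellData (K : Type u) extends Category.{v} K where
  /-- Horizontal morphisms `A ⇸ B`. -/
  HMor : K → K → Type w
  /-- Cells. -/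
  Cell : ∀ {A B C D : K}, HPath HMor A B → Short HMor C D → (A ⟶ C) → (B ⟶ D) → Type z

open CellData

section Paths

variable {K : Type u} [CellData.{u, v, w, z} K]

/-- `CellPath J P f g` is the type of nonempty paths `(φ₁, …, φₙ)` of cells such that the
vertical target of `φᵢ` is the vertical source of `φᵢ₊₁`, where `J` and `P` are the
concatenations of the horizontal sources and of the horizontal targets, and `f` and `g` are the
vertical source of `φ₁` and the vertical target of `φₙ`. The two concatenations are recorded by
equations, so that no transport along equalities of paths is ever needed. -/
inductive CellPath : ∀ {A B C D : K}, HPath (HMor (K := K)) A B → HPath (HMor (K := K)) C D →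
    (A ⟶ C) → (B ⟶ D) → Type (max u v w z)
  | single {A B C D : K} {J : HPath HMor A B} {S : Short HMor C D} {P : HPath HMor C D}
      {f : A ⟶ C} {g : B ⟶ D} (φ : Cell J S f g) (hP : P = S.toPath) : CellPath J P f g
  | cons {A B B' C D D' : K} {J : HPath HMor A B} {S : Short HMor C D}
      {J' : HPath HMor B B'} {P' : HPath HMor D D'} {J'' : HPath HMor A B'} {P'' : HPath HMor C D'}
      {f : A ⟶ C} {g : B ⟶ D} {h : B' ⟶ D'}
      (φ : Cell J S f g) (Φ : CellPath J' P' g h)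
      (hJ : J'' = J.comp J') (hP : P'' = S.toPath.comp P') : CellPath J'' P'' f h

/-- Concatenation of paths of cells. -/
def CellPath.append : ∀ {A B B' C D D' : K} {J : HPath HMor A B} {P : HPath HMor C D}
    {J' : HPath HMor B B'} {P' : HPath HMor D D'} {J'' : HPath HMor A B'} {P'' : HPath HMor C D'}
    {f : A ⟶ C} {g : B ⟶ D} {h : B' ⟶ D'},
    CellPath J P f g → CellPath J' P' g h → J'' = J.comp J' → P'' = P.comp P' →
      CellPath J'' P'' f h
  | _, _, _, _, _, _, _, _, _, _, _, _, _, _, _, .single φ h, Ψ, hJ, hP =>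
      .cons φ Ψ hJ (by rw [hP, h])
  | _, _, _, _, _, _, _, _, _, _, _, _, _, _, _, .cons φ Φ h h', Ψ, hJ, hP =>
      .cons φ (CellPath.append Φ Ψ rfl rfl) (by rw [hJ, h, HPath.comp_assoc])
        (by rw [hP, h', HPath.comp_assoc])

/-- Two composable layers of cells: a nonempty sequence of pairs `(Φᵢ, ψᵢ)`, each consisting of
a path of cells `Φᵢ` and a cell `ψᵢ` that can be composed with it, such that the vertical targets
of `Φᵢ` and `ψᵢ` are the vertical sources of `Φᵢ₊₁` and `ψᵢ₊₁`. -/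
inductive CellGrid : ∀ {A B C D E G : K}, HPath (HMor (K := K)) A B → HPath (HMor (K := K)) C D →
    HPath (HMor (K := K)) E G → (A ⟶ C) → (B ⟶ D) → (C ⟶ E) → (D ⟶ G) → Type (max u v w z)
  | single {A B C D E G : K} {J : HPath HMor A B} {M : HPath HMor C D} {S : Short HMor E G}
      {P : HPath HMor E G} {f : A ⟶ C} {g : B ⟶ D} {h : C ⟶ E} {k : D ⟶ G}
      (Φ : CellPath J M f g) (ψ : Cell M S h k) (hP : P = S.toPath) : CellGrid J M P f g h k
  | cons {A B B' C D D' E G G' : K} {J : HPath HMor A B} {M : HPath HMor C D} {S : Short HMor E G}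
      {J' : HPath HMor B B'} {M' : HPath HMor D D'} {P' : HPath HMor G G'}
      {J'' : HPath HMor A B'} {M'' : HPath HMor C D'} {P'' : HPath HMor E G'}
      {f : A ⟶ C} {g : B ⟶ D} {g' : B' ⟶ D'} {h : C ⟶ E} {k : D ⟶ G} {k' : D' ⟶ G'}
      (Φ : CellPath J M f g) (ψ : Cell M S h k) (T : CellGrid J' M' P' g g' k k')
      (hJ : J'' = J.comp J') (hM : M'' = M.comp M') (hP : P'' = S.toPath.comp P') :
      CellGrid J'' M'' P'' f g' h k'

/-- The lower layer `(ψ₁, …, ψₙ)`. -/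
def CellGrid.lower : ∀ {A B C D E G : K} {J : HPath HMor A B} {M : HPath HMor C D}
    {P : HPath HMor E G} {f : A ⟶ C} {g : B ⟶ D} {h : C ⟶ E} {k : D ⟶ G},
    CellGrid J M P f g h k → CellPath M P h k
  | _, _, _, _, _, _, _, _, _, _, _, _, _, .single _ ψ hP => .single ψ hP
  | _, _, _, _, _, _, _, _, _, _, _, _, _, .cons _ ψ T _ hM hP => .cons ψ T.lower hM hP

/-- The upper layer: the concatenation of the paths `Φ₁, …, Φₙ`. -/
def CellGrid.upper : ∀ {A B C D E G : K} {J : HPath HMor A B} {M : HPath HMor C D}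
    {P : HPath HMor E G} {f : A ⟶ C} {g : B ⟶ D} {h : C ⟶ E} {k : D ⟶ G},
    CellGrid J M P f g h k → CellPath J M f g
  | _, _, _, _, _, _, _, _, _, _, _, _, _, .single Φ _ _ => Φ
  | _, _, _, _, _, _, _, _, _, _, _, _, _, .cons Φ _ T hJ hM _ => Φ.append T.upper hJ hM

end Paths

/-- Composition and identities. The vertical source and target of a composite are `f ≫ h` and
`g ≫ k`; they are recorded by equations, so that no transport along equalities of vertical
morphisms is ever needed, and similarly for the vertical morphisms of horizontal identity
cells. -/
class CellOps (K : Type u) extends CellData.{u, v, w, z} K where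
  /-- The vertical composite `ψ ∘ (φ₁, …, φₙ)`. -/
  vcomp : ∀ {A B C D E G : K} {J : HPath HMor A B} {P : HPath HMor C D} {S : Short HMor E G}
    {f : A ⟶ C} {g : B ⟶ D} {h : C ⟶ E} {k : D ⟶ G} {f' : A ⟶ E} {g' : B ⟶ G},
    CellPath J P f g → Cell P S h k → f' = f ≫ h → g' = g ≫ k → Cell J S f' g'
  /-- The horizontal identity cell `id_J : J ⇒ J`. -/
  hid : ∀ {A B : K} (J : HMor A B) {f : A ⟶ A} {g : B ⟶ B}, f = 𝟙 A → g = 𝟙 B →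
    Cell (HPath.cons J (HPath.nil B)) (Short.un J) f g
  /-- The vertical identity cell `id_f`. -/
  vid : ∀ {A C : K} (f : A ⟶ C), Cell (HPath.nil A) (Short.nul C) f f

open CellOps

section Ops

variable {K : Type u} [CellOps.{u, v, w, z} K]

/-- The path `(ψ₁ ∘ Φ₁, …, ψₙ ∘ Φₙ)`. -/
def CellGrid.composites : ∀ {A B C D E G : K} {J : HPath HMor A B} {M : HPath HMor C D}
    {P : HPath HMor E G} {f : A ⟶ C} {g : B ⟶ D} {h : C ⟶ E} {k : D ⟶ G},
    CellGrid J M P f g h k → CellPath J P (f ≫ h) (g ≫ k)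
  | _, _, _, _, _, _, _, _, _, _, _, _, _, .single Φ ψ hP => .single (vcomp Φ ψ rfl rfl) hP
  | _, _, _, _, _, _, _, _, _, _, _, _, _, .cons Φ ψ T hJ _ hP =>
      .cons (vcomp Φ ψ rfl rfl) T.composites hJ hP

/-- The path of identity cells `(id_{J₁}, …, id_{Jₙ})` of a path `J`, to be read as the single
vertical identity cell `id_A` if `J` is the empty path at `A`. -/
def idPath : ∀ {A B : K} (J : HPath HMor A B), CellPath J J (𝟙 A) (𝟙 B)
  | _, _, .nil A => .single (vid (𝟙 A)) rfl
  | _, _, .cons J (.nil _) => .single (hid J rfl rfl) rfl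
  | _, _, .cons J (.cons J' Js) => .cons (hid J rfl rfl) (idPath (.cons J' Js)) rfl rfl

end Ops

/-- Augmented virtual double categories. -/
class AugmentedVirtualDoubleCategory (K : Type u) extends CellOps.{u, v, w, z} K where
  /-- Vertical identity cells are preserved by composition: `id_h ∘ id_f = id_{h ∘ f}`. -/
  vid_vid : ∀ {A C E : K} (f : A ⟶ C) (h : C ⟶ E),
    vcomp (.single (vid f) rfl) (vid h) rfl rfl = vid (f ≫ h)
  /-- Associativity: `χ ∘ (ψ₁ ∘ Φ₁, …, ψₙ ∘ Φₙ) = (χ ∘ (ψ₁, …, ψₙ)) ∘ (Φ₁ ⌢ ⋯ ⌢ Φₙ)`. -/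
  vassoc : ∀ {A B C D E G X Y : K} {J : HPath HMor A B} {M : HPath HMor C D} {P : HPath HMor E G}
    {S : Short HMor X Y} {f : A ⟶ C} {g : B ⟶ D} {h : C ⟶ E} {k : D ⟶ G} {p : E ⟶ X} {q : G ⟶ Y}
    (T : CellGrid J M P f g h k) (χ : Cell P S p q),
    vcomp T.composites χ (Category.assoc f h p).symm (Category.assoc g k q).symm =
      vcomp T.upper (vcomp T.lower χ rfl rfl) rfl rfl
  /-- `id_C ∘ φ = φ` for nullary cells `φ`. -/
  vid_comp : ∀ {A B C : K} {J : HPath HMor A B} {f : A ⟶ C} {g : B ⟶ C}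
    (φ : Cell J (.nul C) f g),
    vcomp (.single φ rfl) (vid (𝟙 C)) (Category.comp_id f).symm (Category.comp_id g).symm = φ
  /-- `id_P ∘ φ = φ` for unary cells `φ`. -/
  hid_comp : ∀ {A B C D : K} {J : HPath HMor A B} {P : HMor C D} {f : A ⟶ C} {g : B ⟶ D}
    (φ : Cell J (.un P) f g),
    vcomp (.single φ rfl) (hid P rfl rfl) (Category.comp_id f).symm (Category.comp_id g).symm = φ
  /-- `φ ∘ (id_{J₁}, …, id_{Jₙ}) = φ`, and `φ ∘ id_A = φ` if the horizontal source is empty. -/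
  comp_ids : ∀ {A B C D : K} {J : HPath HMor A B} {S : Short HMor C D} {f : A ⟶ C} {g : B ⟶ D}
    (φ : Cell J S f g),
    vcomp (idPath J) φ (Category.id_comp f).symm (Category.id_comp g).symm = φ
  /-- `ψ ∘ (id_f, φ₁, …, φₙ) = ψ ∘ (φ₁, …, φₙ)`. -/
  insert_left : ∀ {A B C D E G : K} {J : HPath HMor A B} {P : HPath HMor C D} {S : Short HMor E G}
    {f : A ⟶ C} {g : B ⟶ D} {h : C ⟶ E} {k : D ⟶ G} (Φ : CellPath J P f g) (ψ : Cell P S h k),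
    vcomp (.cons (vid f) Φ rfl rfl) ψ rfl rfl = vcomp Φ ψ rfl rfl
  /-- `ψ ∘ (φ₁, …, φₙ, id_g) = ψ ∘ (φ₁, …, φₙ)`. -/
  insert_right : ∀ {A B C D E G : K} {J : HPath HMor A B} {P : HPath HMor C D} {S : Short HMor E G}
    {f : A ⟶ C} {g : B ⟶ D} {h : C ⟶ E} {k : D ⟶ G} (Φ : CellPath J P f g) (ψ : Cell P S h k),
    vcomp (Φ.append (.single (vid g) rfl) J.comp_nil.symm P.comp_nil.symm) ψ rfl rfl =
      vcomp Φ ψ rfl rfl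
  /-- `ψ ∘ (φ₁, …, φᵢ, id_g, φᵢ₊₁, …, φₙ) = ψ ∘ (φ₁, …, φₙ)`. -/
  insert_mid : ∀ {A B B' C D D' E G : K} {J : HPath HMor A B} {P : HPath HMor C D}
    {J' : HPath HMor B B'} {P' : HPath HMor D D'} {S : Short HMor E G}
    {f : A ⟶ C} {g : B ⟶ D} {g' : B' ⟶ D'} {h : C ⟶ E} {k : D' ⟶ G}
    (Φ : CellPath J P f g) (Φ' : CellPath J' P' g g') (ψ : Cell (P.comp P') S h k),
    vcomp (Φ.append (.cons (vid g) Φ' rfl rfl) rfl rfl) ψ rfl rfl =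
      vcomp (Φ.append Φ' rfl rfl) ψ rfl rfl

/-! ### Functors -/

/-- The data of a functor of augmented virtual double categories. -/
structure CellMap (K : Type u) (L : Type u') [CellData.{u, v, w, z} K]
    [CellData.{u', v', w', z'} L] extends K ⥤ L where
  /-- The action on horizontal morphisms. -/
  hmap : ∀ {A B : K}, HMor A B → HMor (obj A) (obj B)
  /-- The action on cells. -/
  cmap : ∀ {A B C D : K} {J : HPath HMor A B} {S : Short HMor C D} {f : A ⟶ C} {g : B ⟶ D},
    Cell J S f g → Cell (J.map obj hmap) (S.map obj hmap) (map f) (map g)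

/-- The image `(Fφ₁, …, Fφₙ)` of a path of cells. -/
def CellMap.pathMap {K : Type u} {L : Type u'} [CellData.{u, v, w, z} K]
    [CellData.{u', v', w', z'} L] (F : CellMap K L) :
    ∀ {A B C D : K} {J : HPath HMor A B} {P : HPath HMor C D} {f : A ⟶ C} {g : B ⟶ D},
      CellPath J P f g →
        CellPath (J.map F.obj F.hmap) (P.map F.obj F.hmap) (F.map f) (F.map g)
  | _, _, _, _, _, _, _, _, .single φ hP => .single (F.cmap φ) (by rw [hP, Short.map_toPath])
  | _, _, _, _, _, _, _, _, .cons φ Φ hJ hP =>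
      .cons (F.cmap φ) (F.pathMap Φ) (by rw [hJ, HPath.map_comp])
        (by rw [hP, HPath.map_comp, Short.map_toPath])

/-- Functors of augmented virtual double categories: they preserve composition and identities
strictly. -/
structure AVDFunctor (K : Type u) (L : Type u') [AugmentedVirtualDoubleCategory.{u, v, w, z} K]
    [AugmentedVirtualDoubleCategory.{u', v', w', z'} L] extends CellMap K L where
  cmap_vcomp : ∀ {A B C D E G : K} {J : HPath HMor A B} {P : HPath HMor C D} {S : Short HMor E G}
    {f : A ⟶ C} {g : B ⟶ D} {h : C ⟶ E} {k : D ⟶ G} (Φ : CellPath J P f g) (ψ : Cell P S h k),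
    cmap (vcomp Φ ψ rfl rfl) =
      vcomp (toCellMap.pathMap Φ) (cmap ψ) (map_comp f h) (map_comp g k)
  cmap_hid : ∀ {A B : K} (J : HMor A B),
    cmap (hid J rfl rfl) = hid (hmap J) (map_id A) (map_id B)
  cmap_vid : ∀ {A C : K} (f : A ⟶ C), cmap (vid f) = vid (map f)

/-- The image `FJ` of a path. -/
abbrev AVDFunctor.onPath {K : Type u} {L : Type u'} [AugmentedVirtualDoubleCategory.{u, v, w, z} K]
    [AugmentedVirtualDoubleCategory.{u', v', w', z'} L] (F : AVDFunctor K L) {A B : K}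
    (J : HPath (HMor (K := K)) A B) : HPath (HMor (K := L)) (F.obj A) (F.obj B) :=
  J.map F.obj F.hmap

section

variable {K : Type u} [AugmentedVirtualDoubleCategory.{u, v, w, z} K]

/-! ### Nullary cells and their horizontal composition -/

/-- The horizontal composite `φ ⊙ ψ = id_M ∘ (φ, ψ)` of nullary cells. -/
def hcomp {A B C M : K} {J : HPath HMor A B} {H : HPath HMor B C} {P : HPath HMor A C}
    {f : A ⟶ M} {g : B ⟶ M} {h : C ⟶ M}
    (φ : Cell J (.nul M) f g) (ψ : Cell H (.nul M) g h) (hP : P = J.comp H) :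
    Cell P (.nul M) f h :=
  vcomp (.cons φ (.single ψ rfl) hP rfl) (vid (𝟙 M))
    (Category.comp_id f).symm (Category.comp_id h).symm

/-- The composite `e ∘ φ` of a nullary cell and a vertical morphism. -/
def postcomp {A B M N : K} {J : HPath HMor A B} {f : A ⟶ M} {g : B ⟶ M}
    (φ : Cell J (.nul M) f g) (e : M ⟶ N) : Cell J (.nul N) (f ≫ e) (g ≫ e) :=
  vcomp (.single φ rfl) (vid e) rfl rfl

/-- Vertical cells `f ⇒ g`. -/
abbrev VCell {A C : K} (f g : A ⟶ C) := Cell (HPath.nil A) (.nul C) f g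

/-- `f ≅ g`: there exists an invertible vertical cell `f ⇒ g`. -/
def VIso {A C : K} (f g : A ⟶ C) : Prop :=
  ∃ (σ : VCell f g) (τ : VCell g f), hcomp σ τ rfl = vid f ∧ hcomp τ σ rfl = vid g

theorem vassoc_single {A B C D E G X Y : K} {J : HPath HMor A B} {M : HPath HMor C D}
    {T : Short HMor E G} {P : HPath HMor E G} {S : Short HMor X Y} {f : A ⟶ C} {g : B ⟶ D}
    {h : C ⟶ E} {k : D ⟶ G} {f' : A ⟶ E} {g' : B ⟶ G} {p : E ⟶ X} {q : G ⟶ Y}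
    {f'' : A ⟶ X} {g'' : B ⟶ Y} {h' : C ⟶ X} {k' : D ⟶ Y}
    (Φ : CellPath J M f g) (ψ : Cell M T h k) (χ : Cell P S p q) (hP : P = T.toPath)
    (e₁ : f' = f ≫ h) (e₂ : g' = g ≫ k) (e₃ : f'' = f' ≫ p) (e₄ : g'' = g' ≫ q)
    (e₅ : h' = h ≫ p) (e₆ : k' = k ≫ q) (e₇ : f'' = f ≫ h') (e₈ : g'' = g ≫ k') :
    vcomp (.single (vcomp Φ ψ e₁ e₂) hP) χ e₃ e₄ =
      vcomp Φ (vcomp (.single ψ hP) χ e₅ e₆) e₇ e₈ := by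
  subst e₁ e₂ e₅ e₆ e₇ e₈
  exact AugmentedVirtualDoubleCategory.vassoc (.single Φ ψ hP) χ

theorem vassoc_pair {A B B' C D D' E G G' X Y : K} {J : HPath HMor A B} {M : HPath HMor C D}
    {J' : HPath HMor B B'} {M' : HPath HMor D D'}
    {T : Short HMor E G} {T' : Short HMor G G'} {P : HPath HMor E G'} {P' : HPath HMor G G'}
    {J'' : HPath HMor A B'} {S : Short HMor X Y} {f : A ⟶ C} {g : B ⟶ D} {r : B' ⟶ D'}
    {h : C ⟶ E} {k : D ⟶ G} {l : D' ⟶ G'} {f' : A ⟶ E} {g' : B ⟶ G} {r' : B' ⟶ G'}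
    {p : E ⟶ X} {q : G' ⟶ Y}
    {f'' : A ⟶ X} {r'' : B' ⟶ Y} {h' : C ⟶ X} {l' : D' ⟶ Y}
    (Φ : CellPath J M f g) (ψ : Cell M T h k) (Φ' : CellPath J' M' g r) (ψ' : Cell M' T' k l)
    (χ : Cell P S p q) (hJ : J'' = J.comp J') (hP' : P' = T'.toPath) (hP : P = T.toPath.comp P')
    (e₁ : f' = f ≫ h) (e₂ : g' = g ≫ k) (e₂' : r' = r ≫ l)
    (e₃ : f'' = f' ≫ p) (e₄ : r'' = r' ≫ q)
    (e₅ : h' = h ≫ p) (e₆ : l' = l ≫ q) (e₇ : f'' = f ≫ h') (e₈ : r'' = r ≫ l') :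
    vcomp (.cons (vcomp Φ ψ e₁ e₂) (.single (vcomp Φ' ψ' e₂ e₂') hP') hJ hP) χ e₃ e₄ =
      vcomp (Φ.append Φ' hJ rfl) (vcomp (.cons ψ (.single ψ' hP') rfl hP) χ e₅ e₆) e₇ e₈ := by
  subst e₁ e₂ e₂' e₅ e₆ e₇ e₈
  exact AugmentedVirtualDoubleCategory.vassoc (.cons Φ ψ (.single Φ' ψ' hP') hJ rfl hP) χ

theorem vid_comp' {A B C : K} {J : HPath HMor A B} {f : A ⟶ C} {g : B ⟶ C}
    (φ : Cell J (.nul C) f g) (e : f = f ≫ 𝟙 C) (e' : g = g ≫ 𝟙 C) :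
    vcomp (.single φ rfl) (vid (𝟙 C)) e e' = φ :=
  AugmentedVirtualDoubleCategory.vid_comp φ

/-- `ψ ∘ (id, φ) = ψ ∘ φ`. -/
theorem insert_left' {A B C D E G : K} {J : HPath HMor A B} {P : HPath HMor C D}
    {S : Short HMor E G} {f : A ⟶ C} {g : B ⟶ D} {h : C ⟶ E} {k : D ⟶ G}
    {f' : A ⟶ E} {g' : B ⟶ G} (Φ : CellPath J P f g) (ψ : Cell P S h k)
    (e : f' = f ≫ h) (e' : g' = g ≫ k) :
    vcomp (.cons (vid f) Φ rfl rfl) ψ e e' = vcomp Φ ψ e e' := by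
  subst e e'
  exact AugmentedVirtualDoubleCategory.insert_left Φ ψ

/-- `ψ ∘ (φ, id) = ψ ∘ φ` for nullary `φ`. -/
theorem insert_right' {A B C E G : K} {J J' : HPath HMor A B}
    {S : Short HMor E G} {f : A ⟶ C} {g : B ⟶ C} {h : C ⟶ E} {k : C ⟶ G}
    {f' : A ⟶ E} {g' : B ⟶ G} (φ : Cell J (.nul C) f g) (ψ : Cell (.nil C) S h k)
    (hJ : J' = J) (hJ' : J' = J.comp (.nil B)) (e : f' = f ≫ h) (e' : g' = g ≫ k) :
    vcomp (.cons φ (.single (vid g) rfl) hJ' rfl) ψ e e' =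
      vcomp (.single (hJ ▸ φ) rfl) ψ e e' := by
  subst e e' hJ
  exact AugmentedVirtualDoubleCategory.insert_right (.single φ rfl) ψ

theorem vid_hcomp {A B M : K} {J : HPath HMor A B} {f : A ⟶ M} {g : B ⟶ M}
    (φ : Cell J (.nul M) f g) : hcomp (vid f) φ rfl = φ :=
  (insert_left' _ _ _ _).trans (vid_comp' φ _ _)

theorem hcomp_vid {A B M : K} {J : HPath HMor A B} {f : A ⟶ M} {g : B ⟶ M}
    (φ : Cell J (.nul M) f g) : hcomp φ (vid g) J.comp_nil.symm = φ :=
  (insert_right' φ _ rfl _ _ _).trans (vid_comp' φ _ _)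

/-- `id_M ∘ (id_M, id_M) = id_M`. -/
theorem vid_vid_vid (M : K) (e : 𝟙 M = 𝟙 M ≫ 𝟙 M) :
    vcomp (.cons (vid (𝟙 M)) (.single (vid (𝟙 M)) rfl) rfl rfl) (vid (𝟙 M)) e e = vid (𝟙 M) :=
  (insert_left' _ _ _ _).trans (vid_comp' _ _ _)

theorem hcomp_assoc {A B C D M : K} {J : HPath HMor A B} {H : HPath HMor B C} {G : HPath HMor C D}
    {P : HPath HMor A D} {Q : HPath HMor A C} {R : HPath HMor B D}
    {f : A ⟶ M} {g : B ⟶ M} {h : C ⟶ M} {k : D ⟶ M}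
    (φ : Cell J (.nul M) f g) (ψ : Cell H (.nul M) g h) (χ : Cell G (.nul M) h k)
    (hQ : Q = J.comp H) (p : P = Q.comp G) (hR : R = H.comp G) (q : P = J.comp R) :
    hcomp (hcomp φ ψ hQ) χ p = hcomp φ (hcomp ψ χ hR) q := by
  have e : 𝟙 M = 𝟙 M ≫ 𝟙 M := (Category.comp_id _).symm
  have e' : ∀ {X : K} (a : X ⟶ M), a = a ≫ 𝟙 M := fun a => (Category.comp_id a).symm
  subst hQ hR
  calc hcomp (hcomp φ ψ rfl) χ p
      = hcomp (hcomp φ ψ rfl) (vcomp (.single χ rfl) (vid (𝟙 M)) (e' h) (e' k)) p := by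
        rw [vid_comp']
    _ = vcomp (.cons φ (.cons ψ (.single χ rfl) rfl rfl) q rfl) (vid (𝟙 M)) (e' f) (e' k) := by
        refine (vassoc_pair _ _ _ _ _ p rfl rfl _ _ _ _ _ e e (e' f) (e' k)).trans ?_
        rw [vid_vid_vid]
        rfl
    _ = hcomp (vcomp (.single φ rfl) (vid (𝟙 M)) (e' f) (e' g)) (hcomp ψ χ rfl) q := by
        refine ((vassoc_pair _ _ _ _ _ q rfl rfl _ _ _ _ _ e e (e' f) (e' k)).trans ?_).symm
        rw [vid_vid_vid]
        rfl
    _ = hcomp φ (hcomp ψ χ rfl) q := by rw [vid_comp']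

theorem postcomp_vid {A M N : K} (f : A ⟶ M) (e : M ⟶ N) :
    postcomp (vid f) e = vid (f ≫ e) :=
  AugmentedVirtualDoubleCategory.vid_vid f e

theorem postcomp_hcomp {A B C M N : K} {J : HPath HMor A B} {H : HPath HMor B C}
    {P : HPath HMor A C} {f : A ⟶ M} {g : B ⟶ M} {h : C ⟶ M}
    (φ : Cell J (.nul M) f g) (ψ : Cell H (.nul M) g h) (hP : P = J.comp H) (e : M ⟶ N) :
    postcomp (hcomp φ ψ hP) e = hcomp (postcomp φ e) (postcomp ψ e) hP := by
  have e₁ : e = 𝟙 M ≫ e := (Category.id_comp e).symm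
  have e₂ : e = e ≫ 𝟙 N := (Category.comp_id e).symm
  have h₁ : vcomp (.single (vid (𝟙 M)) rfl) (vid e) e₁ e₁ = vid e :=
    AugmentedVirtualDoubleCategory.comp_ids (vid e)
  have h₂ : vcomp (.cons (vid e) (.single (vid e) rfl) rfl rfl) (vid (𝟙 N)) e₂ e₂ = vid e :=
    (insert_left' _ _ _ _).trans (vid_comp' _ _ _)
  refine (vassoc_single _ _ _ rfl _ _ _ _ e₁ e₁ rfl rfl).trans ?_
  refine Eq.trans ?_ (vassoc_pair _ _ _ _ _ hP rfl rfl _ _ _ _ _ e₂ e₂ rfl rfl).symm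
  rw [h₁, h₂]
  rfl

end

section

variable {K : Type u} [AugmentedVirtualDoubleCategory.{u, v, w, z} K]
  {L : Type u'} [AugmentedVirtualDoubleCategory.{u', v', w', z'} L]

theorem AVDFunctor.cmap_vcomp' (F : AVDFunctor K L)
    {A B C D E G : K} {J : HPath HMor A B} {P : HPath HMor C D} {S : Short HMor E G}
    {f : A ⟶ C} {g : B ⟶ D} {h : C ⟶ E} {k : D ⟶ G} {f' : A ⟶ E} {g' : B ⟶ G}
    (Φ : CellPath J P f g) (ψ : Cell P S h k) (e : f' = f ≫ h) (e' : g' = g ≫ k)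
    (d : F.map f' = F.map f ≫ F.map h) (d' : F.map g' = F.map g ≫ F.map k) :
    F.cmap (vcomp Φ ψ e e') = vcomp (F.pathMap Φ) (F.cmap ψ) d d' := by
  subst e e'
  exact F.cmap_vcomp Φ ψ

theorem vcomp_congr_vid {A B C : K} {J : HPath HMor A B} {f : A ⟶ C} {g : B ⟶ C}
    (Φ : CellPath J (.nil C) f g) {i : C ⟶ C} (hi : i = 𝟙 C) (e : f = f ≫ i) (e' : g = g ≫ i)
    (d : f = f ≫ 𝟙 C) (d' : g = g ≫ 𝟙 C) :
    vcomp Φ (vid i) e e' = vcomp Φ (vid (𝟙 C)) d d' := by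
  subst hi
  rfl

theorem AVDFunctor.cmap_hcomp (F : AVDFunctor K L) {A B C M : K} {J : HPath HMor A B}
    {H : HPath HMor B C} {P : HPath HMor A C} {f : A ⟶ M} {g : B ⟶ M} {h : C ⟶ M}
    (φ : Cell J (.nul M) f g) (ψ : Cell H (.nul M) g h) (hP : P = J.comp H)
    (hP' : F.onPath P = (F.onPath J).comp (F.onPath H)) :
    (F.cmap (hcomp φ ψ hP) : Cell (F.onPath P) (.nul (F.obj M)) (F.map f) (F.map h)) =
      hcomp (F.cmap φ) (F.cmap ψ) hP' := by
  have d : ∀ {X : K} (a : X ⟶ M), F.map a = F.map a ≫ F.map (𝟙 M) := fun a => by simp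
  refine (F.cmap_vcomp' _ _ _ _ (d f) (d h)).trans ?_
  rw [F.cmap_vid]
  exact vcomp_congr_vid _ (F.map_id M) _ _ _ _

theorem sigma_hcomp {A B C M : L} {E : Type*} (p : E → HPath (HMor (K := L)) A C)
    {J : HPath HMor A B} {G : HPath HMor B C} {f : A ⟶ M} {g : B ⟶ M} {h : C ⟶ M}
    {φ : Cell J (.nul M) f g} {ψ : Cell G (.nul M) g h} {H H' : E}
    {χ : Cell (p H') (.nul M) f h} (hP : p H = J.comp G) (e : H = H')
    (hχ : ∀ hP' : p H' = J.comp G, hcomp φ ψ hP' = χ) :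
    (⟨H, hcomp φ ψ hP⟩ : Σ P : E, Cell (p P) (.nul M) f h) = ⟨H', χ⟩ := by
  subst e
  exact congrArg (Sigma.mk H) (hχ hP)

/-! ### The categories `K / C` and `F / X` -/

/-- Objects of `K / C`: vertical morphisms `A ⟶ C` of `K`. -/
structure Slice (C : K) where
  {pt : K}
  hom : pt ⟶ C

/-- The category `K / C`: a morphism from `f : A ⟶ C` to `g : B ⟶ C` consists of a path
`H : A ⇸ B` and a nullary cell `H ⇒ C` with vertical source `f` and vertical target `g`.
Composition is horizontal composition. This is `F / C` for `F` the identity functor of `K`. -/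
instance (C : K) : Category (Slice C) where
  Hom X Y := Σ H : HPath HMor X.pt Y.pt, Cell H (.nul C) X.hom Y.hom
  id X := ⟨.nil _, vid X.hom⟩
  comp φ ψ := ⟨φ.1.comp ψ.1, hcomp φ.2 ψ.2 rfl⟩
  id_comp φ := sigma_hcomp (fun P => P) rfl rfl fun _ => vid_hcomp φ.2
  comp_id φ := sigma_hcomp (fun P => P) rfl φ.1.comp_nil fun _ => hcomp_vid φ.2
  assoc φ ψ χ := sigma_hcomp (fun P => P) rfl (HPath.comp_assoc φ.1 ψ.1 χ.1) fun _ =>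
    hcomp_assoc φ.2 ψ.2 χ.2 _ _ _ _

/-- Objects of `F / X`: pairs of an object `A` of `K` and a vertical morphism `FA ⟶ X` of `L`. -/
structure Comma (F : AVDFunctor K L) (X : L) where
  pt : K
  hom : F.obj pt ⟶ X

/-- The category `F / X`: a morphism from `(A, f)` to `(B, g)` consists of a path `H : A ⇸ B` in
`K` and a nullary cell `FH ⇒ X` in `L` with vertical source `f` and vertical target `g`.
Composition is horizontal composition. -/
instance (F : AVDFunctor K L) (X : L) : Category (Comma F X) where
  Hom Y Z := Σ H : HPath HMor Y.pt Z.pt, Cell (F.onPath H) (.nul X) Y.hom Z.hom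
  id Y := ⟨.nil _, vid Y.hom⟩
  comp φ ψ := ⟨φ.1.comp ψ.1, hcomp φ.2 ψ.2 (HPath.map_comp _ _ _ _)⟩
  id_comp φ := sigma_hcomp F.onPath rfl rfl fun _ => vid_hcomp φ.2
  comp_id φ := sigma_hcomp F.onPath (HPath.map_comp _ _ _ _) φ.1.comp_nil fun _ => hcomp_vid φ.2
  assoc φ ψ χ := sigma_hcomp F.onPath (HPath.map_comp _ _ _ _)
    (HPath.comp_assoc φ.1 ψ.1 χ.1) fun _ => hcomp_assoc φ.2 ψ.2 χ.2 _ _ _ _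

/-- The functor `ε ∘ F– : K / C' ⥤ F / C` of a vertical morphism `ε : FC' ⟶ C`. -/
def sliceFunctor (F : AVDFunctor K L) {C' : K} {C : L} (ε : F.obj C' ⟶ C) :
    Slice C' ⥤ Comma F C where
  obj X := ⟨X.pt, F.map X.hom ≫ ε⟩
  map φ := ⟨φ.1, postcomp (F.cmap φ.2) ε⟩
  map_id X := congrArg (Sigma.mk _) <|
    (congrArg (fun c => postcomp c ε) (F.cmap_vid X.hom)).trans (postcomp_vid _ _)
  map_comp φ ψ := congrArg (Sigma.mk _) <|
    (congrArg (fun c => postcomp c ε) (F.cmap_hcomp φ.2 ψ.2 rfl (HPath.map_comp _ _ _ _))).trans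
      (postcomp_hcomp _ _ _ _)

/-- `ε : FC' ⟶ C` is locally universal from `F` to `C`: the functor `ε ∘ F–` is full and
faithful. -/
def IsLocallyUniversal (F : AVDFunctor K L) {C' : K} {C : L} (ε : F.obj C' ⟶ C) : Prop :=
  (sliceFunctor F ε).Full ∧ (sliceFunctor F ε).Faithful

/-- `ε : FC' ⟶ C` is universal relative to the full subcategory `𝒥` of `F / C`: it is locally
universal and `ε ∘ F–` factors through the inclusion of `𝒥` as an equivalence `K / C' ≌ 𝒥`. -/
def IsUniversalRelativeTo (F : AVDFunctor K L) {C' : K} {C : L} (ε : F.obj C' ⟶ C)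
    (𝒥 : ObjectProperty (Comma F C)) : Prop :=
  IsLocallyUniversal F ε ∧
    ∃ h : ∀ X, 𝒥 ((sliceFunctor F ε).obj X), (𝒥.lift (sliceFunctor F ε) h).IsEquivalence

end

/-! ### Cartesian cells, left Kan cells and Yoneda embeddings -/

section

variable {K : Type u} [AugmentedVirtualDoubleCategory.{u, v, w, z} K]

/-- A cell `ψ : J ⇒ S`, where `J` has length at most one, is cartesian if every cell `χ : H ⇒ S`
with vertical source `f ∘ h` and vertical target `g ∘ k` factors uniquely as `χ = ψ ∘ φ`. -/
def IsCartesian {A B C D : K} (J : Short HMor A B) {S : Short HMor C D} {f : A ⟶ C} {g : B ⟶ D}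
    (ψ : Cell J.toPath S f g) : Prop :=
  ∀ ⦃X Y : K⦄ (H : HPath HMor X Y) (h : X ⟶ A) (k : Y ⟶ B) (χ : Cell H S (h ≫ f) (k ≫ g)),
    ∃! φ : Cell H J h k, vcomp (.single φ rfl) ψ rfl rfl = χ

/-- Nullary cells `J ⇒ M` whose horizontal source is a single horizontal morphism. -/
abbrev NCell {A B M : K} (J : HMor A B) (f : A ⟶ M) (g : B ⟶ M) :=
  Cell (Short.un J).toPath (.nul M) f g

/-- `A` is unital: there is a horizontal unit `I : A ⇸ A`, that is a cartesian nullary cell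
`I ⇒ A` with identities as vertical source and target. -/
def IsUnital (A : K) : Prop :=
  ∃ (I : HMor A A) (ψ : NCell I (𝟙 A) (𝟙 A)), IsCartesian (.un I) ψ

/-- `f` is full and faithful: its vertical identity cell is cartesian. -/
def IsFullyFaithful {A C : K} (f : A ⟶ C) : Prop :=
  IsCartesian (.nul A) (vid f)

/-- The nullary cell `η : J ⇒ M` is weakly left Kan. -/
def IsWeaklyLeftKan {A B M : K} {J : HPath HMor A B} {d : A ⟶ M} {l : B ⟶ M}
    (η : Cell J (.nul M) d l) : Prop :=
  ∀ (k : B ⟶ M) (φ : Cell J (.nul M) d k),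
    ∃! φ' : VCell l k, hcomp η φ' J.comp_nil.symm = φ

/-- The nullary cell `η : J ⇒ M` is left Kan. -/
def IsLeftKan {A B M : K} {J : HPath HMor A B} {d : A ⟶ M} {l : B ⟶ M}
    (η : Cell J (.nul M) d l) : Prop :=
  ∀ ⦃C : K⦄ (H : HPath HMor B C) (k : C ⟶ M) (φ : Cell (J.comp H) (.nul M) d k),
    ∃! φ' : Cell H (.nul M) l k, hcomp η φ' rfl = φ

/-- `f` is weakly dense: cartesian nullary cells `J ⇒ M` with vertical source `f` are weakly left
Kan. -/
def IsWeaklyDense {A M : K} (f : A ⟶ M) : Prop :=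
  ∀ ⦃B : K⦄ (J : HMor A B) (l : B ⟶ M) (η : NCell J f l), IsCartesian (.un J) η →
    IsWeaklyLeftKan η

/-- `f` is dense: cartesian nullary cells `J ⇒ M` with vertical source `f` are left Kan. -/
def IsDense {A M : K} (f : A ⟶ M) : Prop :=
  ∀ ⦃B : K⦄ (J : HMor A B) (l : B ⟶ M) (η : NCell J f l), IsCartesian (.un J) η → IsLeftKan η

/-- `l` is a morphism `J^λ` as supplied by the Yoneda axiom for `y`: it is equipped with a
cartesian cell that defines `J` as the restriction `P(y, l)`. -/
def IsCurry {A B P : K} (y : A ⟶ P) (J : HMor A B) (l : B ⟶ P) : Prop :=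
  ∃ η : NCell J y l, IsCartesian (.un J) η

/-- Every `J : A ⇸ B` is a restriction `P(y, l)` for some `l : B ⟶ P`. -/
def YonedaAxiom {A P : K} (y : A ⟶ P) : Prop :=
  ∀ ⦃B : K⦄ (J : HMor A B), ∃ l : B ⟶ P, IsCurry y J l

def IsWeakYonedaMorphism {A P : K} (y : A ⟶ P) : Prop := IsWeaklyDense y ∧ YonedaAxiom y

def IsYonedaMorphism {A P : K} (y : A ⟶ P) : Prop := IsDense y ∧ YonedaAxiom y

def IsWeakYonedaEmbedding {A P : K} (y : A ⟶ P) : Prop :=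
  IsWeakYonedaMorphism y ∧ IsFullyFaithful y

def IsYonedaEmbedding {A P : K} (y : A ⟶ P) : Prop :=
  IsYonedaMorphism y ∧ IsFullyFaithful y

end

section

variable {K : Type u} [AugmentedVirtualDoubleCategory.{u, v, w, z} K]
  {L : Type u'} [AugmentedVirtualDoubleCategory.{u', v', w', z'} L]

/-- The full subcategory of `F / P` of all `(B, f : FB ⟶ P)` such that `f ≅ (FJ)^λ` for some
`J : A ⇸ B` in `K`. -/
def curryProperty (F : AVDFunctor K L) {A : K} {P : L} (y : F.obj A ⟶ P) :
    ObjectProperty (Comma F P) :=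
  fun X => ∃ (J : HMor A X.pt) (l : F.obj X.pt ⟶ P), IsCurry y (F.hmap J) l ∧ VIso X.hom l

/-- The functor `ε ∘ F– : K / P' ⥤ F / P` preserves and reflects the cartesian cells that define
restrictions `P'(y, g)`. -/
def PreservesReflectsRestrictions (F : AVDFunctor K L) {A P' : K} {P : L} (ε : F.obj P' ⟶ P)
    (y : A ⟶ P') : Prop :=
  ∀ ⦃B : K⦄ (g : B ⟶ P') (J : HMor A B) (η : NCell J y g),
    IsCartesian (.un J) η ↔ IsCartesian (.un (F.hmap J)) (postcomp (F.cmap η) ε)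

end

end AVDC

open AVDC

/-! Postcomposition `φ ↦ ε ∘ Fφ` is, by full faithfulness, a bijection on nullary cells over a fixed
path of `K`, and it commutes with `⊙`. Unique factorisation through a nullary cell may therefore be
checked after applying it, so it reflects (weakly) left Kan cells
(`IsLocallyUniversal.existsUnique_hcomp`). Moreover cartesian and left Kan cells are stable under
composition with invertible vertical cells, so `y` and `ε ∘ Fy_A` are interchangeable as vertical
sources, and so are `(FJ)^λ` and any `ε ∘ Fg` isomorphic to it.

Density of `y_A` follows: a cartesian cell with source `y_A` is sent to a cartesian cell, hence to a
left Kan one, and left Kan is reflected. For the Yoneda axiom, `(FJ)^λ` is isomorphic to some `ε ∘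
Fg`; the cartesian cell defining `FJ`, conjugated by the two isomorphisms, lifts along the
bijection, and the lift is cartesian by reflection.

Unitality accounts for the rest. A horizontal unit `I` of `A` amounts to mutually inverse cells
between `I` and the empty path. This is equational, so `FI` is again a unit although `F` need not
preserve cartesian cells. Restricting the cell that defines `FI` along the empty path gives `y ≅
(FI)^λ` (`IsHUnit.exists_vIso`), so `(A, y)` lies in the essential image of `ε ∘ F-`, which produces
`y_A`. The same argument inside `K`, applied to `y_A` and `I`, gives a vertical isomorphism that is
also cartesian; composing it with its inverse shows that `id_{y_A}` is cartesian. -/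

namespace AVDC

open CellData CellOps

section

variable {K : Type u} [AugmentedVirtualDoubleCategory.{u, v, w, z} K]

/-! ### Composition laws -/

theorem comp_hid' {A B M : K} {J : HMor A B} {f : A ⟶ M} {g : B ⟶ M} (φ : NCell J f g)
    (e : f = 𝟙 A ≫ f) (e' : g = 𝟙 B ≫ g) :
    vcomp (.single (hid J rfl rfl) rfl) φ e e' = φ :=
  AugmentedVirtualDoubleCategory.comp_ids φ

theorem comp_vid' {A C D : K} {S : Short HMor C D} {f : A ⟶ C} {g : A ⟶ D}
    (φ : Cell (.nil A) S f g) (e : f = 𝟙 A ≫ f) (e' : g = 𝟙 A ≫ g) :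
    vcomp (.single (vid (𝟙 A)) rfl) φ e e' = φ :=
  AugmentedVirtualDoubleCategory.comp_ids φ

theorem vid_vid' {A C E : K} (f : A ⟶ C) (h : C ⟶ E) {k : A ⟶ E} (e e' : k = f ≫ h) :
    vcomp (.single (vid f) rfl) (vid h) e e' = vid k := by
  subst e
  exact AugmentedVirtualDoubleCategory.vid_vid f h

/-- `(σ ⊙ ζ) ∘ φ = (σ ∘ id_h) ⊙ (ζ ∘ φ)` for a vertical cell `σ`. -/
theorem vcomp_hcomp_left {X Y A B M : K} {H : HPath HMor X Y} {J : HPath HMor A B}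
    {h : X ⟶ A} {k : Y ⟶ B} {f' f : A ⟶ M} {g : B ⟶ M} {a b : X ⟶ M} {c : Y ⟶ M}
    (Φ : CellPath H J h k) (σ : VCell f' f) (ζ : Cell J (.nul M) f g)
    (ea : a = h ≫ f') (eb : b = h ≫ f) (ec : c = k ≫ g) :
    vcomp Φ (hcomp σ ζ rfl) ea ec =
      hcomp (vcomp (.single (vid h) rfl) σ ea eb) (vcomp Φ ζ eb ec) rfl := by
  refine Eq.trans ?_ (vassoc_pair (.single (vid h) rfl) σ Φ ζ (vid (𝟙 M)) rfl rfl rfl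
    ea eb ec _ _ (Category.comp_id _).symm (Category.comp_id _).symm ea ec).symm
  exact (insert_left' Φ _ _ _).symm

/-- `(ζ ⊙ τ) ∘ φ = (ζ ∘ φ) ⊙ (τ ∘ id_k)` for a vertical cell `τ`. -/
theorem vcomp_hcomp_right {X Y A B M : K} {H : HPath HMor X Y} {J : HPath HMor A B}
    {h : X ⟶ A} {k : Y ⟶ B} {f : A ⟶ M} {g g' : B ⟶ M} {a : X ⟶ M} {b c : Y ⟶ M}
    (Φ : CellPath H J h k) (ζ : Cell J (.nul M) f g) (τ : VCell g g')
    (ea : a = h ≫ f) (eb : b = k ≫ g) (ec : c = k ≫ g') :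
    vcomp Φ (hcomp ζ τ J.comp_nil.symm) ea ec =
      hcomp (vcomp Φ ζ ea eb) (vcomp (.single (vid k) rfl) τ eb ec) H.comp_nil.symm := by
  subst ea eb ec
  -- `J.comp (.nil B)` equals `J` only propositionally: unit insertion is used at `J`, interchange
  -- at the literal concatenation, and a variable `J'` links the two.
  have key : ∀ (J' : HPath HMor A B) (hJ' : J' = J.comp (.nil B)) (hJ : J' = J),
      vcomp Φ (hcomp ζ τ J.comp_nil.symm) rfl rfl =
      vcomp (Φ.append (.single (vid k) rfl) H.comp_nil.symm hJ') (hcomp ζ τ hJ') rfl rfl := by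
    rintro _ hJ' rfl
    exact (AugmentedVirtualDoubleCategory.insert_right Φ _).symm
  refine Eq.trans (key _ rfl J.comp_nil) ?_
  exact (vassoc_pair Φ ζ (.single (vid k) rfl) τ (vid (𝟙 M)) H.comp_nil.symm rfl rfl
    rfl rfl rfl _ _ (Category.comp_id _).symm (Category.comp_id _).symm rfl rfl).symm

theorem vertical_hcomp_assoc {A B C M : K} {J : HPath HMor A B} {H : HPath HMor B C}
    {P : HPath HMor A C} {e f : A ⟶ M} {g : B ⟶ M} {h : C ⟶ M} (σ : VCell e f)
    (φ : Cell J (.nul M) f g) (χ : Cell H (.nul M) g h) (hP : P = J.comp H) :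
    hcomp (hcomp σ φ rfl) χ hP = hcomp σ (hcomp φ χ hP) rfl :=
  hcomp_assoc σ φ χ rfl hP hP rfl

theorem hcomp_hcomp_cancel_left {A B M : K} {J : HPath HMor A B} {f f' : A ⟶ M} {g : B ⟶ M}
    {σ : VCell f' f} {τ : VCell f f'} (h : hcomp τ σ rfl = vid f) (φ : Cell J (.nul M) f g) :
    hcomp τ (hcomp σ φ rfl) rfl = φ := by
  rw [← vertical_hcomp_assoc, h, vid_hcomp]

theorem hcomp_hcomp_cancel_right {A B M : K} {J : HPath HMor A B} {f : A ⟶ M} {g g' : B ⟶ M}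
    {σ : VCell g g'} {τ : VCell g' g} (h : hcomp σ τ rfl = vid g) (φ : Cell J (.nul M) f g) :
    hcomp (hcomp φ σ J.comp_nil.symm) τ J.comp_nil.symm = φ := by
  rw [hcomp_assoc φ σ τ J.comp_nil.symm J.comp_nil.symm rfl J.comp_nil.symm, h, hcomp_vid]

/-! ### Cartesian cells and invertible vertical cells -/

theorem IsCartesian.existsUnique {A B C D : K} {J : Short HMor A B} {S : Short HMor C D}
    {f : A ⟶ C} {g : B ⟶ D} {ψ : Cell J.toPath S f g} (hψ : IsCartesian J ψ)
    {X Y : K} {H : HPath HMor X Y} {h : X ⟶ A} {k : Y ⟶ B} {f' : X ⟶ C} {g' : Y ⟶ D}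
    (e : f' = h ≫ f) (e' : g' = k ≫ g) (χ : Cell H S f' g') :
    ∃! φ : Cell H J h k, vcomp (.single φ rfl) ψ e e' = χ := by
  subst e e'
  exact hψ H h k χ

/-- Precomposition with a vertical morphism preserves inverse pairs of vertical cells. -/
theorem hcomp_precomp_eq_vid {X A M : K} {f g : A ⟶ M} {σ : VCell f g} {τ : VCell g f}
    (h₁ : hcomp σ τ rfl = vid f) (h : X ⟶ A) :
    hcomp (vcomp (.single (vid h) rfl) σ rfl rfl) (vcomp (.single (vid h) rfl) τ rfl rfl) rfl =
      vid (h ≫ f) := by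
  rw [← vid_vid' h f rfl rfl, ← h₁]
  exact (vcomp_hcomp_left (.single (vid h) rfl) σ τ rfl rfl rfl).symm

/-- Since `σ ∘ id_h` and `τ ∘ id_h` are inverse, the factorisations of `χ` through `σ ⊙ ζ` are
exactly those of `(τ ∘ id_h) ⊙ χ` through `ζ`. -/
theorem IsCartesian.hcomp_left {A B M : K} {J : Short HMor A B} {f f' : A ⟶ M} {g : B ⟶ M}
    {ζ : Cell J.toPath (.nul M) f g} (hζ : IsCartesian J ζ) {σ : VCell f' f} {τ : VCell f f'}
    (h₁ : hcomp σ τ rfl = vid f') (h₂ : hcomp τ σ rfl = vid f) :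
    IsCartesian J (hcomp σ ζ rfl) := by
  intro X Y H h k χ
  obtain ⟨φ, hφ, hu⟩ := hζ H h k (hcomp (vcomp (.single (vid h) rfl) τ rfl rfl) χ rfl)
  refine ⟨φ, ?_, fun φ' hφ' => hu φ' ?_⟩
  · refine (vcomp_hcomp_left _ σ ζ rfl rfl rfl).trans ?_
    rw [hφ, hcomp_hcomp_cancel_left (hcomp_precomp_eq_vid h₁ h)]
  · subst hφ'
    refine Eq.trans ?_ (congrArg
      (fun c => hcomp (vcomp (.single (vid h) rfl) τ rfl rfl) c rfl)
      (vcomp_hcomp_left (.single φ' rfl) σ ζ rfl rfl rfl)).symm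
    rw [hcomp_hcomp_cancel_left (hcomp_precomp_eq_vid h₂ h)]

theorem IsCartesian.hcomp_right {A B M : K} {J : Short HMor A B} {f : A ⟶ M} {g g' : B ⟶ M}
    {ζ : Cell J.toPath (.nul M) f g} (hζ : IsCartesian J ζ) {σ : VCell g g'} {τ : VCell g' g}
    (h₁ : hcomp σ τ rfl = vid g) (h₂ : hcomp τ σ rfl = vid g') :
    IsCartesian J (hcomp ζ σ J.toPath.comp_nil.symm) := by
  intro X Y H h k χ
  obtain ⟨φ, hφ, hu⟩ := hζ H h k
    (hcomp χ (vcomp (.single (vid k) rfl) τ rfl rfl) H.comp_nil.symm)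
  refine ⟨φ, ?_, fun φ' hφ' => hu φ' ?_⟩
  · refine (vcomp_hcomp_right _ ζ σ rfl rfl rfl).trans ?_
    rw [hφ, hcomp_hcomp_cancel_right (hcomp_precomp_eq_vid h₂ k)]
  · subst hφ'
    change _ = hcomp (vcomp _ (hcomp ζ σ _) rfl rfl) _ _
    rw [vcomp_hcomp_right _ ζ σ rfl rfl rfl,
      hcomp_hcomp_cancel_right (hcomp_precomp_eq_vid h₁ k)]

/-- The equations `ζ ⊙ φ' = φ` and `(σ ⊙ ζ) ⊙ φ' = σ ⊙ φ` are equivalent. Cancelling `σ` takes only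
a left inverse, hence the one-sided hypothesis. -/
theorem IsWeaklyLeftKan.of_hcomp_left {A B M : K} {J : HPath HMor A B} {f f' : A ⟶ M} {g : B ⟶ M}
    {ζ : Cell J (.nul M) f g} {σ : VCell f' f} {τ : VCell f f'} (h₂ : hcomp τ σ rfl = vid f)
    (h : IsWeaklyLeftKan (hcomp σ ζ rfl)) : IsWeaklyLeftKan ζ := by
  intro k φ
  obtain ⟨φ', hφ', hu⟩ := h k (hcomp σ φ rfl)
  refine ⟨φ', ?_, fun ψ hψ => hu ψ ?_⟩
  · refine (hcomp_hcomp_cancel_left h₂ _).symm.trans ?_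
    rw [← vertical_hcomp_assoc σ, hφ', hcomp_hcomp_cancel_left h₂]
  · exact (vertical_hcomp_assoc _ _ _ _).trans (congrArg (fun c => hcomp σ c rfl) hψ)

theorem IsLeftKan.of_hcomp_left {A B M : K} {J : HPath HMor A B} {f f' : A ⟶ M} {g : B ⟶ M}
    {ζ : Cell J (.nul M) f g} {σ : VCell f' f} {τ : VCell f f'} (h₂ : hcomp τ σ rfl = vid f)
    (h : IsLeftKan (hcomp σ ζ rfl)) : IsLeftKan ζ := by
  intro C H k φ
  obtain ⟨φ', hφ', hu⟩ := h H k (hcomp σ φ rfl)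
  refine ⟨φ', ?_, fun ψ hψ => hu ψ ?_⟩
  · refine (hcomp_hcomp_cancel_left h₂ _).symm.trans ?_
    rw [← vertical_hcomp_assoc σ, hφ', hcomp_hcomp_cancel_left h₂]
  · exact (vertical_hcomp_assoc _ _ _ _).trans (congrArg (fun c => hcomp σ c rfl) hψ)

/-- The path equation is kept free because `J.comp (.nil B)` and images of concatenations under a
functor agree with the wanted paths only propositionally. -/
theorem IsLeftKan.existsUnique {A B C M : K} {J : HPath HMor A B} {d : A ⟶ M} {l : B ⟶ M}
    {η : Cell J (.nul M) d l} (hη : IsLeftKan η) {H : HPath HMor B C} {P : HPath HMor A C}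
    (hP : P = J.comp H) {k : C ⟶ M} (φ : Cell P (.nul M) d k) :
    ∃! φ' : Cell H (.nul M) l k, hcomp η φ' hP = φ := by
  subst hP
  exact hη H k φ

theorem IsLeftKan.isWeaklyLeftKan {A B M : K} {J : HPath HMor A B} {d : A ⟶ M} {l : B ⟶ M}
    {η : Cell J (.nul M) d l} (hη : IsLeftKan η) : IsWeaklyLeftKan η :=
  fun _ φ => hη.existsUnique J.comp_nil.symm φ

theorem IsDense.isWeaklyDense {A M : K} {f : A ⟶ M} (hf : IsDense f) : IsWeaklyDense f :=
  fun _ J l η hη => (hf J l η hη).isWeaklyLeftKan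

/-! ### Horizontal units -/

/-- `I` is a horizontal unit of `A` in the absolute sense: the empty path at `A` and `I` are
isomorphic by mutually inverse cells `A ⇒ I` and `I ⇒ A`. -/
def IsHUnit {A : K} (I : HMor A A) : Prop :=
  ∃ (φ : Cell (.nil A) (.un I) (𝟙 A) (𝟙 A)) (ψ : NCell I (𝟙 A) (𝟙 A)),
    vcomp (.single φ rfl) ψ (Category.comp_id _).symm (Category.comp_id _).symm = vid (𝟙 A) ∧
    vcomp (.single ψ rfl) φ (Category.comp_id _).symm (Category.comp_id _).symm = hid I rfl rfl

/-- The inverse `φ` is the factorisation of `id_A` through the cartesian cell `ψ`. Then `φ ∘ ψ` and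
`id_I` both factor `ψ` through itself, so they coincide. -/
theorem IsUnital.exists_isHUnit {A : K} (hA : IsUnital A) : ∃ I : HMor A A, IsHUnit I := by
  obtain ⟨I, ψ, hψ⟩ := hA
  have e : 𝟙 A = 𝟙 A ≫ 𝟙 A := (Category.comp_id _).symm
  obtain ⟨φ, hφ, -⟩ := hψ.existsUnique e e (vid (𝟙 A))
  refine ⟨I, φ, ψ, hφ, (hψ.existsUnique e e ψ).unique ?_ (comp_hid' ψ _ _)⟩
  refine (vassoc_single _ _ _ rfl e e e e e e e e).trans ?_
  rw [hφ]
  exact vid_comp' _ _ _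

/-- Serves `IsHUnit.map`, where the image cells have boundary `F.map (𝟙 A)`, equal to the identity
only propositionally. -/
theorem IsHUnit.of_eq_id {A : K} {I : HMor A A} {i : A ⟶ A} (hi : i = 𝟙 A) (e : i = i ≫ i)
    (φ : Cell (.nil A) (.un I) i i) (ψ : NCell I i i)
    (h₁ : vcomp (.single φ rfl) ψ e e = vid i) (h₂ : vcomp (.single ψ rfl) φ e e = hid I hi hi) :
    IsHUnit I := by
  subst hi
  exact ⟨φ, ψ, h₁, h₂⟩

theorem IsHUnit.map {L : Type u'} [AugmentedVirtualDoubleCategory.{u', v', w', z'} L]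
    {A : K} {I : HMor A A} (hI : IsHUnit I) (F : AVDFunctor K L) : IsHUnit (F.hmap I) := by
  obtain ⟨φ, ψ, h₁, h₂⟩ := hI
  have d : F.map (𝟙 A) = F.map (𝟙 A) ≫ F.map (𝟙 A) := by simp
  refine IsHUnit.of_eq_id (F.map_id A) d (F.cmap φ) (F.cmap ψ) ?_ ?_
  · have := congrArg F.cmap h₁
    rw [F.cmap_vcomp' _ _ _ _ d d, F.cmap_vid] at this
    exact this
  · have := congrArg F.cmap h₂
    rw [F.cmap_vcomp' _ _ _ _ d d, F.cmap_hid] at this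
    exact this

/-- Restricting a weakly left Kan cell along a horizontal unit gives an invertible vertical cell,
which is cartesian whenever the given cell is. -/
theorem IsHUnit.exists_vIso {A M : K} {I : HMor A A} (hI : IsHUnit I) {f l : A ⟶ M}
    {η : NCell I f l} (hη : IsWeaklyLeftKan η) :
    ∃ (σ : VCell f l) (τ : VCell l f), hcomp σ τ rfl = vid f ∧ hcomp τ σ rfl = vid l ∧
      (IsCartesian (.un I) η → IsCartesian (.nul A) σ) := by
  obtain ⟨φ, ψ, h₁, h₂⟩ := hI
  have e : ∀ {X : K} (a : A ⟶ X), a = 𝟙 A ≫ a := fun a => (Category.id_comp a).symm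
  -- The inverse `τ` is determined by `η ⊙ τ = id_f ∘ ψ`; the isomorphism itself will be `σ = η ∘
  -- φ`.
  obtain ⟨τ, hτ, -⟩ := hη f (vcomp (.single ψ rfl) (vid f) (e f) (e f))
  have hσ : vcomp (.single ψ rfl) (vcomp (.single φ rfl) η (e f) (e l)) (e f) (e l) = η := by
    refine (vassoc_single (.single ψ rfl) φ η rfl (e _) (e _) (e _) (e _) _ _ _ _).symm.trans ?_
    rw [h₂]
    exact comp_hid' η _ _
  refine ⟨vcomp (.single φ rfl) η (e f) (e l), τ, ?_, ?_, fun hc => ?_⟩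
  -- Precomposing the equation for `τ` with `φ` gives `σ ⊙ τ` on one side and `id_f ∘ (ψ ∘ φ) =
  -- id_f` on the other.
  · have := congrArg (fun c => vcomp (.single φ rfl) c (e f) (e f)) hτ
    refine Eq.trans (Eq.trans ?_ this) ?_
    · refine Eq.trans ?_ (vcomp_hcomp_right (.single φ rfl) η τ (e f) (e l) (e f)).symm
      rw [comp_vid']
    · refine (vassoc_single (.single φ rfl) ψ (vid f) rfl (e _) (e _) (e _) (e _)
        _ _ _ _).symm.trans ?_
      rw [h₁]
      exact vid_vid' _ _ _ _
  -- By uniqueness it suffices that `η ⊙ (τ ⊙ σ) = η`, and the left side is `(id_f ∘ ψ) ⊙ σ = σ ∘ ψ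
  -- = η`.
  · refine (hη l η).unique ?_ (hcomp_vid η)
    rw [← hcomp_assoc _ _ _ (HPath.comp_nil _).symm (HPath.comp_nil _).symm rfl
      (HPath.comp_nil _).symm, hτ]
    refine Eq.trans ?_ hσ
    refine Eq.trans ?_ (congrArg (fun c => vcomp (.single ψ rfl) c (e f) (e l))
      (vid_hcomp (vcomp (.single φ rfl) η (e f) (e l))))
    refine Eq.trans ?_ (vcomp_hcomp_right (.single ψ rfl) (vid f) _ (e f) (e f) (e l)).symm
    rw [comp_vid']
  -- Composition with `ψ` and with `φ` gives inverse bijections between factorisations through `η`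
  -- and through `σ`.
  · intro X Y H h k χ
    have e' : ∀ {Z : K} (a : Z ⟶ A), a = a ≫ 𝟙 A := fun a => (Category.comp_id a).symm
    obtain ⟨θ, hθ, hu⟩ := hc H h k χ
    refine ⟨vcomp (.single θ rfl) ψ (e' h) (e' k), ?_, fun θ' hθ' => ?_⟩
    · refine (vassoc_single (.single θ rfl) ψ _ rfl _ _ _ _ (e _) (e _) rfl rfl).trans ?_
      rw [hσ]
      exact hθ
    · have : vcomp (.single θ' rfl) φ (e' h) (e' k) = θ := by
        refine hu _ ?_
        exact (vassoc_single (.single θ' rfl) φ η rfl _ _ _ _ (e f) (e l) rfl rfl).trans hθ'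
      subst this
      refine Eq.symm ((vassoc_single (.single θ' rfl) φ ψ rfl _ _ _ _ (e _) (e _)
        (e' _) (e' _)).trans ?_)
      rw [h₁]
      exact vid_comp' _ _ _

end

section

variable {K : Type u} [AugmentedVirtualDoubleCategory.{u, v, w, z} K]
  {L : Type u'} [AugmentedVirtualDoubleCategory.{u', v', w', z'} L]

/-! ### Universal morphisms -/

/-- Isomorphisms in `F / C` are vertical: they have empty paths as horizontal components. -/
theorem Comma.exists_hom_of_iso {F : AVDFunctor K L} {C' : K} {C : L} {ε : F.obj C' ⟶ C}
    {X : Slice C'} {B : K} {f : F.obj B ⟶ C} (i : (sliceFunctor F ε).obj X ≅ ⟨B, f⟩) :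
    ∃ g : B ⟶ C', VIso f (F.map g ≫ ε) := by
  obtain ⟨h⟩ := X
  obtain ⟨⟨H, φ⟩, ⟨G, ψ⟩, h₁, h₂⟩ := i
  cases H with
  -- The composite with the inverse has the empty path as horizontal component, so neither factor
  -- can contain a horizontal morphism.
  | cons J H => exact absurd (congrArg Sigma.fst h₁) (by intro h; cases h)
  | nil =>
    cases G with
    | cons J G => exact absurd (congrArg Sigma.fst h₁) (by intro h; cases h)
    | nil => exact ⟨h, ψ, φ, eq_of_heq (Sigma.mk.inj h₂).2, eq_of_heq (Sigma.mk.inj h₁).2⟩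

theorem IsUniversalRelativeTo.exists_hom {F : AVDFunctor K L} {C' : K} {C : L}
    {ε : F.obj C' ⟶ C} {𝒥 : ObjectProperty (Comma F C)} (hε : IsUniversalRelativeTo F ε 𝒥)
    {B : K} {f : F.obj B ⟶ C} (hf : 𝒥 ⟨B, f⟩) : ∃ g : B ⟶ C', VIso f (F.map g ≫ ε) := by
  obtain ⟨-, h, hE⟩ := hε
  exact Comma.exists_hom_of_iso (𝒥.ι.mapIso ((𝒥.lift (sliceFunctor F ε) h).objObjPreimageIso
    ⟨⟨B, f⟩, hf⟩))

/-- The functor `ε ∘ F-` leaves the path component of a morphism unchanged, so bijectivity on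
hom-sets restricts to the cells over each single path. -/
theorem IsLocallyUniversal.existsUnique {F : AVDFunctor K L} {C' : K} {C : L} {ε : F.obj C' ⟶ C}
    (hε : IsLocallyUniversal F ε) {A B : K} {H : HPath HMor A B} {f : A ⟶ C'} {g : B ⟶ C'}
    (χ : Cell (F.onPath H) (.nul C) (F.map f ≫ ε) (F.map g ≫ ε)) :
    ∃! φ : Cell H (.nul C') f g, postcomp (F.cmap φ) ε = χ := by
  obtain ⟨hFull, hFaithful⟩ := hε
  refine existsUnique_of_exists_of_unique ?_ fun φ ψ hφ hψ => ?_
  · obtain ⟨⟨H', φ⟩, hφ⟩ := hFull.map_surjective (X := ⟨f⟩) (Y := ⟨g⟩) ⟨H, χ⟩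
    obtain ⟨rfl, h⟩ := Sigma.mk.inj hφ
    exact ⟨φ, eq_of_heq h⟩
  · have := hFaithful.map_injective (X := ⟨f⟩) (Y := ⟨g⟩) (a₁ := ⟨H, φ⟩) (a₂ := ⟨H, ψ⟩)
      (congrArg (Sigma.mk H) (hφ.trans hψ.symm))
    exact eq_of_heq (Sigma.mk.inj this).2

theorem postcomp_cmap_hcomp (F : AVDFunctor K L) {C' : K} {C : L} (ε : F.obj C' ⟶ C)
    {A B D : K} {J : HPath HMor A B} {H : HPath HMor B D} {P : HPath HMor A D}
    {f : A ⟶ C'} {g : B ⟶ C'} {h : D ⟶ C'} (φ : Cell J (.nul C') f g)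
    (ψ : Cell H (.nul C') g h) (hP : P = J.comp H)
    (hP' : F.onPath P = (F.onPath J).comp (F.onPath H)) :
    postcomp (F.cmap (hcomp φ ψ hP)) ε =
      hcomp (postcomp (F.cmap φ) ε) (postcomp (F.cmap ψ) ε) hP' :=
  (congrArg (fun c => postcomp c ε) (F.cmap_hcomp φ ψ hP hP')).trans (postcomp_hcomp _ _ _ _)

/-- The factor found in `L` is lifted along the bijection on cells. Only paths of the form `FH` are
tested in `L`, which suffices for the left Kan property in `K`. -/
theorem IsLocallyUniversal.existsUnique_hcomp {F : AVDFunctor K L} {C' : K} {C : L}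
    {ε : F.obj C' ⟶ C} (hε : IsLocallyUniversal F ε) {A B D : K} {J : HPath HMor A B}
    {H : HPath HMor B D} {P : HPath HMor A D} {d : A ⟶ C'} {l : B ⟶ C'} {k : D ⟶ C'}
    (η : Cell J (.nul C') d l) (φ : Cell P (.nul C') d k) (hP : P = J.comp H)
    (hP' : F.onPath P = (F.onPath J).comp (F.onPath H))
    (hη : ∃! φ' : Cell (F.onPath H) (.nul C) (F.map l ≫ ε) (F.map k ≫ ε),
      hcomp (postcomp (F.cmap η) ε) φ' hP' = postcomp (F.cmap φ) ε) :
    ∃! φ' : Cell H (.nul C') l k, hcomp η φ' hP = φ := by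
  obtain ⟨χ, hχ, hu⟩ := hη
  obtain ⟨φ', hφ', hu'⟩ := hε.existsUnique χ
  refine ⟨φ', (hε.existsUnique _).unique ?_ rfl, fun ψ hψ => hu' ψ (hu _ ?_)⟩
  · rw [postcomp_cmap_hcomp F ε η φ' hP hP', hφ']
    exact hχ
  · subst hψ
    exact (postcomp_cmap_hcomp F ε η ψ hP hP').symm

theorem IsLocallyUniversal.isWeaklyLeftKan {F : AVDFunctor K L} {C' : K} {C : L}
    {ε : F.obj C' ⟶ C} (hε : IsLocallyUniversal F ε) {A B : K} {J : HPath HMor A B}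
    {d : A ⟶ C'} {l : B ⟶ C'} {η : Cell J (.nul C') d l}
    (hη : IsWeaklyLeftKan (postcomp (F.cmap η) ε)) : IsWeaklyLeftKan η :=
  fun _ φ => hε.existsUnique_hcomp (H := .nil B) η φ _ _ (hη _ _)

theorem IsLocallyUniversal.isLeftKan {F : AVDFunctor K L} {C' : K} {C : L}
    {ε : F.obj C' ⟶ C} (hε : IsLocallyUniversal F ε) {A B : K} {J : HPath HMor A B}
    {d : A ⟶ C'} {l : B ⟶ C'} {η : Cell J (.nul C') d l}
    (hη : IsLeftKan (postcomp (F.cmap η) ε)) : IsLeftKan η :=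
  fun _ _ _ φ => hε.existsUnique_hcomp η φ _ (HPath.map_comp _ _ _ _) (hη.existsUnique _ _)

/-! ### Yoneda morphisms -/

theorem IsWeakYonedaMorphism.exists_vIso {F : AVDFunctor K L} {A : K} (hA : IsUnital A) {P : L}
    {y : F.obj A ⟶ P} (hy : IsWeakYonedaMorphism y) {P' : K} {ε : F.obj P' ⟶ P}
    (hε : IsUniversalRelativeTo F ε (curryProperty F y)) :
    ∃ yA : A ⟶ P', VIso y (F.map yA ≫ ε) := by
  obtain ⟨I, hI⟩ := hA.exists_isHUnit
  obtain ⟨l, η, hη⟩ := hy.2 (F.hmap I)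
  obtain ⟨σ, τ, h₁, h₂, -⟩ := (hI.map F).exists_vIso (hy.1 _ _ η hη)
  -- The horizontal unit `I` witnesses that `(A, y)` belongs to the subcategory: `y ≅ l = (FI)^λ`.
  exact hε.exists_hom ⟨I, l, ⟨η, hη⟩, σ, τ, h₁, h₂⟩

theorem IsUniversalRelativeTo.yonedaAxiom {F : AVDFunctor K L} {A : K} {P : L}
    {y : F.obj A ⟶ P} (hy : YonedaAxiom y) {P' : K} {ε : F.obj P' ⟶ P}
    (hε : IsUniversalRelativeTo F ε (curryProperty F y)) {yA : A ⟶ P'}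
    (hyA : VIso y (F.map yA ≫ ε)) (hF : PreservesReflectsRestrictions F ε yA) :
    YonedaAxiom yA := by
  intro B J
  obtain ⟨l, ζ, hζ⟩ := hy (F.hmap J)
  obtain ⟨σ, τ, h₁, h₂⟩ := hyA
  obtain ⟨g, σ', τ', h₁', h₂'⟩ := hε.exists_hom (B := B) (f := l)
    ⟨J, l, ⟨ζ, hζ⟩, vid l, vid l, vid_hcomp _, vid_hcomp _⟩
  -- Conjugating `ζ` moves its source from `y` to `ε ∘ Fy_A` and its target from `l` to `ε ∘ Fg`, so
  -- that it can be lifted to `K`.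
  obtain ⟨η, hη, -⟩ := hε.1.existsUnique (H := .cons J (.nil B)) (f := yA) (g := g)
    (hcomp (hcomp τ ζ rfl) σ' rfl)
  refine ⟨g, η, (hF g J η).2 ?_⟩
  rw [hη]
  exact (hζ.hcomp_left h₂ h₁).hcomp_right h₁' h₂'

/-- Density uses the preservation half of `hF`, the Yoneda axiom the reflection half. Composing with
`σ` moves the source to `y`, where density is known; `σ` is then stripped off again. -/
theorem IsLocallyUniversal.isWeaklyDense {F : AVDFunctor K L} {A : K} {P : L}
    {y : F.obj A ⟶ P} (hy : IsWeaklyDense y) {P' : K} {ε : F.obj P' ⟶ P}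
    (hε : IsLocallyUniversal F ε) {yA : A ⟶ P'} (hyA : VIso y (F.map yA ≫ ε))
    (hF : PreservesReflectsRestrictions F ε yA) : IsWeaklyDense yA := by
  obtain ⟨σ, τ, h₁, h₂⟩ := hyA
  exact fun B J l η hη => hε.isWeaklyLeftKan
    (.of_hcomp_left h₂ (hy _ _ _ (((hF l J η).1 hη).hcomp_left h₁ h₂)))

theorem IsLocallyUniversal.isDense {F : AVDFunctor K L} {A : K} {P : L}
    {y : F.obj A ⟶ P} (hy : IsDense y) {P' : K} {ε : F.obj P' ⟶ P}
    (hε : IsLocallyUniversal F ε) {yA : A ⟶ P'} (hyA : VIso y (F.map yA ≫ ε))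
    (hF : PreservesReflectsRestrictions F ε yA) : IsDense yA := by
  obtain ⟨σ, τ, h₁, h₂⟩ := hyA
  exact fun B J l η hη => hε.isLeftKan
    (.of_hcomp_left h₂ (hy _ _ _ (((hF l J η).1 hη).hcomp_left h₁ h₂)))

/-- A weak Yoneda morphism out of a unital object is full and faithful. -/
theorem IsWeakYonedaMorphism.isFullyFaithful {A P : K} {y : A ⟶ P} (hy : IsWeakYonedaMorphism y)
    (hA : IsUnital A) : IsFullyFaithful y := by
  obtain ⟨I, hI⟩ := hA.exists_isHUnit
  obtain ⟨l, η, hη⟩ := hy.2 I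
  obtain ⟨σ, τ, h₁, h₂, hσ⟩ := hI.exists_vIso (hy.1 _ _ η hη)
  -- The cell `σ : y ⇒ l` is cartesian and invertible, so `σ ⊙ τ = id_y` is cartesian as well.
  have := (hσ hη).hcomp_right h₂ h₁
  change IsCartesian (.nul A) (hcomp σ τ rfl) at this
  rwa [h₁] at this

end

end AVDC

theorem mainTheorem11
    {K : Type u} [AugmentedVirtualDoubleCategory.{u, v, w, z} K]
    {L : Type u'} [AugmentedVirtualDoubleCategory.{u', v', w', z'} L]
    (F : AVDFunctor K L) {A : K} (hA : IsUnital A) {P : L} (yFA : F.obj A ⟶ P)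
    {P' : K} (ε : F.obj P' ⟶ P) (hε : IsUniversalRelativeTo F ε (curryProperty F yFA)) :
    (IsWeakYonedaMorphism yFA →
      (∃ yA : A ⟶ P', VIso yFA (F.map yA ≫ ε)) ∧
        ∀ yA : A ⟶ P', VIso yFA (F.map yA ≫ ε) → PreservesReflectsRestrictions F ε yA →
          IsWeakYonedaEmbedding yA) ∧
    (IsYonedaMorphism yFA →
      (∃ yA : A ⟶ P', VIso yFA (F.map yA ≫ ε)) ∧
        ∀ yA : A ⟶ P', VIso yFA (F.map yA ≫ ε) → PreservesReflectsRestrictions F ε yA →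
          IsYonedaEmbedding yA) := by
  refine ⟨fun hy => ⟨hy.exists_vIso hA hε, fun yA hyA hF => ?_⟩,
    fun hy => ⟨IsWeakYonedaMorphism.exists_vIso hA ⟨hy.1.isWeaklyDense, hy.2⟩ hε,
      fun yA hyA hF => ?_⟩⟩
  · have h : IsWeakYonedaMorphism yA :=
      ⟨hε.1.isWeaklyDense hy.1 hyA hF, hε.yonedaAxiom hy.2 hyA hF⟩
    exact ⟨h, h.isFullyFaithful hA⟩
  · have h : IsYonedaMorphism yA := ⟨hε.1.isDense hy.1 hyA hF, hε.yonedaAxiom hy.2 hyA hF⟩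
    exact ⟨h, IsWeakYonedaMorphism.isFullyFaithful ⟨h.1.isWeaklyDense, h.2⟩ hA⟩
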